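/- Let $d\ge 1$ be an integer. All graphs are finite and simple. A graph is *chordal* if each of its cycles of length at least $4$ has a chord; it is *$d$-connected* if it has at least $d$ vertices and it remains connected whenever fewer than $d$ vertices are deleted (so $K_d$ is $d$-connected). A placement $p:V\to\mathbb{R}^d$ of the vertices of a graph $H=(V,F)$ is *generic* if its $d|V|$ coordinates are algebraically independent over $\mathbb{Q}$. A pair $\{u,v\}$ of vertices is *globally linked* in $(H,p)$ if $\|q(u)-q(v)\|=\|p(u)-p(v)\|$ for every $q:V\to\mathbb{R}^d$ that satisfies $\|q(x)-q(y)\|=\|p(x)-p(y)\|$ for all edges $xy\in F$. The graph $H$ is *totally loose* in $\mathbb{R}^d$ if no pair of distinct non-adjacent vertices of $H$ is globally linked in $(H,p)$ for any generic $p$. The *totally loose closure* ${\rm tlc}_d(G)$ of $G=(V,E)$ is the unique minimal totally loose (in $\mathbb{R}^d$) supergraph of $G$ on the vertex set $V$. For graphs $G_1,G_2$ with cliques $K_1\subseteq G_1$, $K_2\subseteq G_2$ on $t$ vertices each, a *$t$-clique sum* of $G_1$ and $G_2$ is a graph obtained from their disjoint union by identifying the vertices of $K_1$ with those of $K_2$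 along some bijection. **Statement.** Let $G$ be a $d$-connected chordal graph. Then ${\rm tlc}_d(G)$ can be obtained from complete graphs by a (possibly empty) sequence of $d$-clique sum operations; that is, ${\rm tlc}_d(G)$ is a clique sum of complete graphs along cliques of size exactly $d$. -/

import Mathlib

namespace Rigidity

/-- A `d`-dimensional framework on vertex set `V` places every vertex at a point of `ℝ^d`. -/
abbrev Placement (V : Type*) (d : ℕ) := V → EuclideanSpace ℝ (Fin d)

/-- The `d|V|` vertex coordinates are algebraically independent over `ℚ`. -/
def IsGeneric {V : Type*} {d : ℕ} (p : Placement V d) : Prop :=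
  AlgebraicIndependent ℚ (fun x : V × Fin d => p x.1 x.2)

/-- The frameworks `(G,p)` and `(G,q)` have the same edge lengths. -/
def Equivalent {V : Type*} {d : ℕ} (G : SimpleGraph V) (p q : Placement V d) : Prop :=
  ∀ u v, G.Adj u v → dist (p u) (p v) = dist (q u) (q v)

/-- The pair `{u,v}` is globally linked in the framework `(G,p)`. -/
def GloballyLinkedIn {V : Type*} {d : ℕ} (G : SimpleGraph V) (p : Placement V d) (u v : V) :
    Prop :=
  ∀ q : Placement V d, Equivalent G p q → dist (p u) (p v) = dist (q u) (q v)

/-- The pair `{u,v}` is globally linked in some generic `d`-dimensional framework `(G,p)`. -/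
def WeaklyGloballyLinked {V : Type*} (d : ℕ) (G : SimpleGraph V) (u v : V) : Prop :=
  ∃ p : Placement V d, IsGeneric p ∧ GloballyLinkedIn G p u v

/-- The pair `{u,v}` is globally loose in `G` in `ℝ^d`. -/
def GloballyLoose {V : Type*} (d : ℕ) (G : SimpleGraph V) (u v : V) : Prop :=
  ¬ WeaklyGloballyLinked d G u v

/-- All pairs of distinct non-adjacent vertices are globally loose. -/
def TotallyLoose {V : Type*} (d : ℕ) (G : SimpleGraph V) : Prop :=
  ∀ u v, u ≠ v → ¬ G.Adj u v → GloballyLoose d G u v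

/-- The totally loose closure of `G` in `ℝ^d`: the intersection of all totally loose supergraphs of
`G` on the same vertex set. By `isLeast_tlc` it is the unique minimal such supergraph. -/
def tlc {V : Type*} (d : ℕ) (G : SimpleGraph V) : SimpleGraph V :=
  sInf {H | G ≤ H ∧ TotallyLoose d H}

theorem WeaklyGloballyLinked.mono {V : Type*} {d : ℕ} {G H : SimpleGraph V} (h : G ≤ H) {u v : V}
    (hw : WeaklyGloballyLinked d G u v) : WeaklyGloballyLinked d H u v := by
  obtain ⟨p, hp, hl⟩ := hw
  exact ⟨p, hp, fun q hq => hl q fun a b hab => hq a b (h hab)⟩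

theorem isLeast_tlc {V : Type*} (d : ℕ) (G : SimpleGraph V) :
    IsLeast {H : SimpleGraph V | G ≤ H ∧ TotallyLoose d H} (tlc d G) := by
  refine ⟨⟨le_sInf fun H hH => hH.1, fun u v huv hadj hw => hadj ?_⟩, fun H hH => sInf_le hH⟩
  rw [tlc, SimpleGraph.sInf_adj]
  refine ⟨fun H hH => ?_, huv⟩
  by_contra hn
  exact hH.2 u v huv hn (hw.mono (sInf_le hH))

/-- Every cycle of length at least four has a chord: an edge joining two vertices of the cycle that
is not an edge of the cycle. -/
def IsChordal {V : Type*} (G : SimpleGraph V) : Prop :=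
  ∀ (v : V) (c : G.Walk v v), c.IsCycle → 4 ≤ c.length →
    ∃ x y, x ∈ c.support ∧ y ∈ c.support ∧ G.Adj x y ∧ s(x, y) ∉ c.edges

/-- `G` has at least `k` vertices and remains connected after deleting fewer than `k` vertices
(so the complete graph on `k` vertices counts as `k`-connected). -/
def IsKConnected {V : Type*} (k : ℕ) (G : SimpleGraph V) : Prop :=
  k ≤ Nat.card V ∧ ∀ S : Finset V, S.card < k → (G.induce ((S : Set V)ᶜ)).Connected

/-- `G` arises (up to isomorphism) from `G₁` and `G₂` by a `t`-clique sum: `G₁` and `G₂` sit in `G`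
as induced subgraphs that together cover all vertices and all edges, and whose common vertices form
a clique with exactly `t` vertices. -/
def IsCliqueSum {V₁ V₂ V : Type*} (t : ℕ) (G₁ : SimpleGraph V₁) (G₂ : SimpleGraph V₂)
    (G : SimpleGraph V) : Prop :=
  ∃ (f₁ : G₁ ↪g G) (f₂ : G₂ ↪g G),
    Set.range f₁ ∪ Set.range f₂ = Set.univ ∧
    G.IsClique (Set.range f₁ ∩ Set.range f₂) ∧
    (Set.range f₁ ∩ Set.range f₂).encard = t ∧
    ∀ x y, G.Adj x y →
      (x ∈ Set.range f₁ ∧ y ∈ Set.range f₁) ∨ (x ∈ Set.range f₂ ∧ y ∈ Set.range f₂)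

/-- `G` is obtained from complete graphs by a (possibly empty) sequence of `t`-clique sums. -/
inductive IsCliqueSumOfComplete.{u} (t : ℕ) : ∀ {V : Type u}, SimpleGraph V → Prop
  | complete {V : Type u} (G : SimpleGraph V) (h : G = ⊤) : IsCliqueSumOfComplete t G
  | sum {V₁ V₂ V : Type u} (G₁ : SimpleGraph V₁) (G₂ : SimpleGraph V₂) (G : SimpleGraph V)
      (h₁ : IsCliqueSumOfComplete t G₁) (h₂ : IsCliqueSumOfComplete t G₂)
      (h : IsCliqueSum t G₁ G₂ G) : IsCliqueSumOfComplete t G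

end Rigidity

/-!
A chordal graph that is not complete has a proper separation `(A, B)` of minimum order, and its
boundary `A ∩ B` is a clique (`IsChordal.isClique_inter`): two non-adjacent boundary vertices would
be joined by chordless paths through `A \ B` and through `B \ A`, and these would close up to a
chordless cycle. Cutting along a clique keeps both parts chordal and creates no separation of smaller
order, so one can argue by induction on the number of vertices.

Suppose first that every proper separation has more than `d` boundary vertices. For a generic
placement no hyperplane contains `d + 1` of the points (`IsGeneric.inGeneralPosition`). By induction
an equivalent placement preserves all distances within `A` and all distances within `B`; the common
points span the space affinely, so it preserves the distances between `A` and `B` as well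
(`InGeneralPosition.dist_eq`). Thus all pairs are globally linked (`IsChordal.globallyLinkedIn`).

In general, the minimum order of a proper separation of a `d`-connected graph is at least `d`. When
it is exactly `d`, the closures of the two parts are glued along the clique `A ∩ B`; when it is
larger, the closure is complete (`IsChordal.exists_cliqueSum`). The resulting graph `H` is a clique
sum of complete graphs along `d`-cliques. It adds to `G` only globally linked pairs, and each
non-adjacent pair of `H` is separated by exactly `d` vertices. Such a pair is globally loose, since
one side can be reflected in the hyperplane through the `d` common points
(`IsSeparation.globallyLoose`). Hence `H` is the totally loose closure of `G`
(`tlc_eq_of_globallyLinkedIn`).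
-/

namespace Rigidity

open Set

/-! ### Separations -/

/-- `(A, B)` is a separation of `G`: the two sides cover all vertices and no edge joins `A \ B`
to `B \ A`. Since the sides cover, `x ∉ B` means `x ∈ A \ B`. -/
structure IsSeparation {V : Type*} (G : SimpleGraph V) (A B : Set V) : Prop where
  union_eq : A ∪ B = univ
  not_adj : ∀ ⦃x y⦄, x ∉ B → y ∉ A → ¬ G.Adj x y

/-- Every separation of `G` with both sides proper has order `|A ∩ B|` at least `k`. For graphs
with at least `k` vertices this is `k`-connectedness. -/
def SeparationsOrderGE {V : Type*} (k : ℕ) (G : SimpleGraph V) : Prop :=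
  ∀ ⦃A B : Set V⦄, IsSeparation G A B → Aᶜ.Nonempty → Bᶜ.Nonempty → k ≤ (A ∩ B).ncard

variable {V : Type*} {G : SimpleGraph V} {A B : Set V}

theorem IsSeparation.mem_or_mem (h : IsSeparation G A B) (x : V) : x ∈ A ∨ x ∈ B := by
  have : x ∈ A ∪ B := h.union_eq ▸ mem_univ x
  exact this

theorem IsSeparation.symm (h : IsSeparation G A B) : IsSeparation G B A :=
  ⟨by rw [union_comm, h.union_eq], fun _ _ hx hy hxy => h.not_adj hy hx hxy.symm⟩

/-- Both ends of an edge lie on a common side. -/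
theorem IsSeparation.mem_and_mem_of_adj (h : IsSeparation G A B) {x y : V} (hxy : G.Adj x y) :
    (x ∈ A ∧ y ∈ A) ∨ (x ∈ B ∧ y ∈ B) := by
  have hx := h.mem_or_mem x
  have hy := h.mem_or_mem y
  have h₁ : x ∉ B → y ∉ A → False := fun hx hy => h.not_adj hx hy hxy
  have h₂ : y ∉ B → x ∉ A → False := fun hy hx => h.not_adj hy hx hxy.symm
  tauto

/-- A clique lies on one side of every separation. -/
theorem IsSeparation.subset_or_subset_of_isClique (h : IsSeparation G A B) {K : Set V}
    (hK : G.IsClique K) : K ⊆ A ∨ K ⊆ B := by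
  by_contra! hn
  obtain ⟨⟨x, hx, hxA⟩, ⟨y, hy, hyB⟩⟩ := And.imp not_subset.1 not_subset.1 hn
  have hne : y ≠ x := by
    rintro rfl
    exact (h.mem_or_mem y).elim hxA hyB
  exact h.not_adj hyB hxA (hK hy hx hne)

theorem IsKConnected.separationsOrderGE [Finite V] {k : ℕ} (h : IsKConnected k G) :
    SeparationsOrderGE k G := by
  rintro A B hs ⟨y, hy⟩ ⟨x, hx⟩
  by_contra! hlt
  have hfin := (A ∩ B).toFinite
  have hc := h.2 hfin.toFinset (by rwa [← ncard_eq_toFinset_card _ hfin])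
  obtain ⟨w⟩ := hc.preconnected ⟨x, by simp_all⟩ ⟨y, by simp_all⟩
  obtain ⟨e, -, he₁, he₂⟩ := w.exists_boundary_dart {z | z.1 ∉ B} hx
    (by simpa using (hs.mem_or_mem y).resolve_left hy)
  have h2 := e.snd.2
  simp only [mem_ofPred_eq, not_not] at he₁ he₂
  exact hs.not_adj he₁ (fun hA => h2 (Finset.mem_coe.2 (hfin.mem_toFinset.2 ⟨hA, he₂⟩))) e.adj

/-- Two distinct non-adjacent vertices are separated by all the others. -/
theorem isSeparation_compl_singleton {a b : V} (hab : a ≠ b) (hadj : ¬ G.Adj a b) :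
    IsSeparation G {b}ᶜ {a}ᶜ := by
  refine ⟨?_, ?_⟩
  · ext x
    by_cases h : x = a <;> simp [h, hab]
  · intro x y hx hy
    simp only [mem_compl_iff, mem_singleton_iff, not_not] at hx hy
    subst hx hy
    exact hadj

/-- A separation `(C, D)` of one part `G[A]` of `G` extends to a separation of `G`: `B` is added to
the side `C`. If `C` contains the boundary `A ∩ B`, this does not change the order; see
`inter_extend_eq`. -/
theorem IsSeparation.extend (h : IsSeparation G A B) {C D : Set A}
    (hs : IsSeparation (G.induce A) C D) :
    IsSeparation G (Subtype.val '' C ∪ B) (Subtype.val '' D) := by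
  refine ⟨?_, ?_⟩
  · refine eq_univ_of_forall fun x => ?_
    by_cases hx : x ∈ A
    · rcases hs.mem_or_mem ⟨x, hx⟩ with h' | h'
      · exact Or.inl (Or.inl ⟨_, h', rfl⟩)
      · exact Or.inr ⟨_, h', rfl⟩
    · exact Or.inl (Or.inr ((h.mem_or_mem x).resolve_left hx))
  · intro x y hx hy hxy
    have hyB : y ∉ B := fun hB => hy (Or.inr hB)
    have hyA := (h.mem_or_mem y).resolve_right hyB
    have hyC : (⟨y, hyA⟩ : A) ∉ C := fun hC => hy (Or.inl ⟨_, hC, rfl⟩)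
    by_cases hxA : x ∈ A
    · exact hs.not_adj (x := ⟨x, hxA⟩) (y := ⟨y, hyA⟩) (fun hD => hx ⟨_, hD, rfl⟩) hyC hxy
    · exact h.not_adj hyB hxA hxy.symm

theorem inter_extend_eq {C D : Set A} (hC : ∀ x : A, x.1 ∈ B → x ∈ C) :
    (Subtype.val '' C ∪ B) ∩ (Subtype.val '' D) = Subtype.val '' (C ∩ D) := by
  ext x
  constructor
  · rintro ⟨hx | hx, ⟨y, hy, rfl⟩⟩
    · obtain ⟨z, hz, hzy⟩ := hx
      exact ⟨y, ⟨Subtype.ext hzy ▸ hz, hy⟩, rfl⟩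
    · exact ⟨y, ⟨hC y hx, hy⟩, rfl⟩
  · rintro ⟨y, ⟨hy, hy'⟩, rfl⟩
    exact ⟨Or.inl ⟨y, hy, rfl⟩, ⟨y, hy', rfl⟩⟩

/-- If `C` contains the boundary of the part `A`, a vertex outside `C` stays outside after
extending `C` by `B`. -/
theorem notMem_extend {C : Set A} (hC : ∀ x : A, x.1 ∈ B → x ∈ C) {x : A} (hx : x ∉ C) :
    x.1 ∉ Subtype.val '' C ∪ B := by
  rintro (⟨y, hy, hyx⟩ | h)
  · exact hx (Subtype.ext hyx ▸ hy)
  · exact hx (hC x h)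

theorem notMem_image_val {D : Set A} {x : A} (hx : x ∉ D) : x.1 ∉ Subtype.val '' D := by
  rintro ⟨y, hy, hyx⟩
  exact hx (Subtype.ext hyx ▸ hy)

theorem isClique_induce_of_inter (hK : G.IsClique (A ∩ B)) :
    (G.induce A).IsClique {x : A | x.1 ∈ B} := fun x hx y hy hne =>
  hK ⟨x.2, hx⟩ ⟨y.2, hy⟩ fun e => hne (Subtype.ext e)

/-- Cutting along a clique does not create separations of small order. -/
theorem SeparationsOrderGE.induce_left {k : ℕ} (hG : SeparationsOrderGE k G)
    (h : IsSeparation G A B) (hK : G.IsClique (A ∩ B)) :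
    SeparationsOrderGE k (G.induce A) := by
  have key : ∀ C D : Set A, IsSeparation (G.induce A) C D → Cᶜ.Nonempty → Dᶜ.Nonempty →
      (∀ x : A, x.1 ∈ B → x ∈ C) → k ≤ (C ∩ D).ncard := by
    rintro C D hs ⟨y, hy⟩ ⟨x, hx⟩ hC
    have := hG (h.extend hs) ⟨y, notMem_extend hC hy⟩ ⟨x, notMem_image_val hx⟩
    rwa [inter_extend_eq hC, ncard_image_of_injective _ Subtype.val_injective] at this
  intro C D hs hC hD
  rcases hs.subset_or_subset_of_isClique (isClique_induce_of_inter hK) with h' | h'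
  · exact key C D hs hC hD h'
  · rw [inter_comm]
    exact key D C hs.symm hD hC h'

/-! ### Minimum separations of chordal graphs -/

theorem IsChordal.induce (hG : IsChordal G) (A : Set V) : IsChordal (G.induce A) := by
  intro v c hc hlen
  let f : G.induce A ↪g G := SimpleGraph.Embedding.induce A
  obtain ⟨x, y, hx, hy, hxy, hne⟩ := hG (f v) (c.map f.toHom)
    ((SimpleGraph.Walk.isCycle_map_iff_of_injective f.injective).2 hc) (by simpa using hlen)
  simp only [SimpleGraph.Walk.support_map, List.mem_map] at hx hy
  obtain ⟨x, hx, rfl⟩ := hx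
  obtain ⟨y, hy, rfl⟩ := hy
  refine ⟨x, y, hx, hy, f.map_adj_iff.1 hxy, fun he => hne ?_⟩
  rw [SimpleGraph.Walk.edges_map, List.mem_map]
  exact ⟨_, he, rfl⟩

/-- A shortest walk among those staying inside a given set is a chordless path. -/
theorem exists_chordless_path {x y : V} (D : Set V)
    (h : ∃ w : G.Walk x y, ∀ t ∈ w.support, t ∈ D) :
    ∃ w : G.Walk x y, w.IsPath ∧ w.IsChordless ∧ ∀ t ∈ w.support, t ∈ D := by
  classical
  have hex : ∃ n, ∃ w : G.Walk x y, (∀ t ∈ w.support, t ∈ D) ∧ w.length = n :=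
    h.imp' SimpleGraph.Walk.length fun w hw => ⟨w, hw, rfl⟩
  obtain ⟨w, hwD, hwl⟩ := Nat.find_spec hex
  have hmin : ∀ w' : G.Walk x y, (∀ t ∈ w'.support, t ∈ D) → w.length ≤ w'.length :=
    fun w' hw' => hwl ▸ Nat.find_min' hex ⟨w', hw', rfl⟩
  have hshort : ∀ i j, i ≤ j → j ≤ w.length → G.Adj (w.getVert i) (w.getVert j) →
      s(w.getVert i, w.getVert j) ∈ w.edges := by
    intro i j hij hj hadj
    have hne : i ≠ j := by
      rintro rfl
      exact hadj.ne rfl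
    have := hmin ((w.take i).append (.cons hadj (w.drop j))) (by
      intro t ht
      rw [SimpleGraph.Walk.mem_support_append_iff, SimpleGraph.Walk.support_cons,
        List.mem_cons] at ht
      rcases ht with ht | rfl | ht
      · exact hwD _ ((w.isSubwalk_take i).support_subset ht)
      · exact hwD _ (w.getVert_mem_support _)
      · exact hwD _ ((w.isSubwalk_drop j).support_subset ht))
    rw [SimpleGraph.Walk.length_append, SimpleGraph.Walk.length_cons,
      SimpleGraph.Walk.take_length, SimpleGraph.Walk.drop_length] at this
    -- the shortcut along the edge is not shorter, so it joins consecutive vertices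
    obtain rfl : j = i + 1 := by omega
    rw [SimpleGraph.Walk.mk_mem_edges_iff_exists]
    exact ⟨i, by omega, rfl⟩
  refine ⟨w.bypass, w.bypass_isPath, ?_, fun t ht => hwD t (w.support_bypass_subset_support ht)⟩
  have hw : w.bypass = w := w.bypass_eq_self_of_length_le_length_bypass
    (hmin _ fun t ht => hwD t (w.support_bypass_subset_support ht))
  rw [hw, SimpleGraph.Walk.isChordless_iff_forall_mem_edges]
  intro u v hu hv hadj
  obtain ⟨i, rfl, hi⟩ := SimpleGraph.Walk.mem_support_iff_exists_getVert.1 hu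
  obtain ⟨j, rfl, hj⟩ := SimpleGraph.Walk.mem_support_iff_exists_getVert.1 hv
  rcases le_total i j with hij | hij
  · exact hshort i j hij hj hadj
  · rw [Sym2.eq_swap]
    exact hshort j i hij hi hadj.symm

/-- For a separation of minimum order, any two vertices `x`, `y` of `A ∩ B` are joined through
`A \ B`: otherwise the component of `a` in `G - B` would be cut off by fewer vertices. -/
theorem IsSeparation.exists_walk_of_minimal [Finite V] (h : IsSeparation G A B) {a : V}
    (ha : a ∉ B) (hA : Aᶜ.Nonempty) (hmin : SeparationsOrderGE (A ∩ B).ncard G)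
    {x y : V} (hx : x ∈ A ∩ B) (hy : y ∈ A ∩ B) :
    ∃ w : G.Walk x y, ∀ t ∈ w.support, t ∈ {x, y} ∪ Bᶜ := by
  let C : Set V := {z | ∃ w : G.Walk a z, ∀ t ∈ w.support, t ∉ B}
  have hCB : ∀ z ∈ C, z ∉ B := fun z ⟨w, hw⟩ => hw z w.end_mem_support
  have haC : a ∈ C := ⟨.nil, by simpa using ha⟩
  have key : ∀ s ∈ A ∩ B, ∃ z ∈ C, G.Adj z s := by
    intro s hs
    by_contra! hn
    -- if `s` has no neighbour in `C`, then the other boundary vertices already cut off `C`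
    have hinter : (C ∪ ((A ∩ B) \ {s})) ∩ Cᶜ = (A ∩ B) \ {s} := by
      ext z
      have := hCB z
      simp only [mem_inter_iff, mem_union, mem_sdiff, mem_compl_iff]
      tauto
    have hsep : IsSeparation G (C ∪ ((A ∩ B) \ {s})) Cᶜ := by
      refine ⟨?_, ?_⟩
      · ext z
        simp only [mem_union, mem_compl_iff, mem_univ, iff_true]
        tauto
      · intro u v hu hv huv
        rw [notMem_compl_iff] at hu
        have hvC : v ∉ C := fun h => hv (Or.inl h)
        have hvA : v ∈ A := by
          by_contra hvA
          exact h.not_adj (hCB u hu) hvA huv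
        by_cases hvB : v ∈ B
        · have : v = s := by
            by_contra hvs
            exact hv (Or.inr ⟨⟨hvA, hvB⟩, hvs⟩)
          exact hn u hu (this ▸ huv)
        · obtain ⟨w, hw⟩ := hu
          refine hvC ⟨w.concat huv, fun t ht => ?_⟩
          rw [SimpleGraph.Walk.support_concat, List.mem_append,
            List.mem_singleton] at ht
          rcases ht with ht | rfl
          · exact hw t ht
          · exact hvB
    obtain ⟨b, hb⟩ := hA
    have hbB := (h.mem_or_mem b).resolve_left hb
    have := hmin hsep ⟨b, fun hb' => hb'.elim (fun hC => hCB b hC hbB) fun h => hb h.1.1⟩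
      ⟨a, fun h => h haC⟩
    rw [hinter] at this
    exact absurd (ncard_sdiff_singleton_lt_of_mem hs) (not_lt.2 this)
  obtain ⟨z, ⟨w, hw⟩, hzx⟩ := key x hx
  obtain ⟨z', ⟨w', hw'⟩, hzy⟩ := key y hy
  refine ⟨.cons hzx.symm (w.reverse.append (w'.concat hzy)), fun t ht => ?_⟩
  simp only [SimpleGraph.Walk.support_cons, List.mem_cons,
    SimpleGraph.Walk.mem_support_append_iff, SimpleGraph.Walk.support_reverse, List.mem_reverse,
    SimpleGraph.Walk.support_concat, List.mem_append,
    List.not_mem_nil, or_false] at ht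
  rcases ht with rfl | ht | ht | rfl
  · exact Or.inl (Or.inl rfl)
  · exact Or.inr (hw t ht)
  · exact Or.inr (hw' t ht)
  · exact Or.inl (Or.inr rfl)

/-- In a chordal graph the boundary of a minimum separation is a clique: two non-adjacent vertices
of it would be joined by chordless paths through either side, which form a chordless cycle. -/
theorem IsChordal.isClique_inter [Finite V] (hG : IsChordal G) (h : IsSeparation G A B)
    (hA : Aᶜ.Nonempty) (hB : Bᶜ.Nonempty) (hmin : SeparationsOrderGE (A ∩ B).ncard G) :
    G.IsClique (A ∩ B) := by
  intro x hx y hy hne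
  by_contra hadj
  obtain ⟨a, ha⟩ := hB
  obtain ⟨b, hb⟩ := id hA
  obtain ⟨p, hp, hpc, hpB⟩ := exists_chordless_path _
    (h.exists_walk_of_minimal ha hA hmin hx hy)
  obtain ⟨q, hq, hqc, hqA⟩ := exists_chordless_path _
    (h.symm.exists_walk_of_minimal hb ⟨a, ha⟩ (by rwa [inter_comm]) hy.symm hx.symm)
  have hlen : ∀ {u v : V} (w : G.Walk u v), u ≠ v → ¬ G.Adj u v → 2 ≤ w.length := by
    intro u v w huv hadj
    by_contra! hlt
    interval_cases hw : w.length
    · exact huv (SimpleGraph.Walk.eq_of_length_eq_zero hw)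
    · exact hadj (SimpleGraph.Walk.adj_of_length_eq_one hw)
  have hp2 := hlen p hne hadj
  have hq2 := hlen q hne.symm fun h => hadj h.symm
  have hxp : x ∉ p.support.tail := by
    have := hp.support_nodup
    rw [← p.cons_tail_support] at this
    exact (List.nodup_cons.1 this).1
  have hyq : y ∉ q.support.tail := by
    have := hq.support_nodup
    rw [← q.cons_tail_support] at this
    exact (List.nodup_cons.1 this).1
  have hcyc : (p.append q).IsCycle := by
    refine hp.isCycle_append hq (fun t htp htq => ?_) (Or.inl hp2)
    have h1 := hpB t (List.mem_of_mem_tail htp)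
    have h2 := hqA t (List.mem_of_mem_tail htq)
    have htx : t ≠ x := fun e => hxp (e ▸ htp)
    have hty : t ≠ y := fun e => hyq (e ▸ htq)
    simp only [mem_union, mem_insert_iff, mem_singleton_iff, htx, hty, mem_compl_iff,
      false_or] at h1 h2
    exact (h.mem_or_mem t).elim h2 h1
  obtain ⟨u, v, hu, hv, huv, hne'⟩ := hG x _ hcyc (by
    rw [SimpleGraph.Walk.length_append]
    omega)
  rw [SimpleGraph.Walk.mem_support_append_iff] at hu hv
  rw [SimpleGraph.Walk.edges_append, List.mem_append, not_or] at hne'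
  -- no edge joins the interiors of the two paths, so a chord has both ends on the same path
  have hboth : ∀ u v, u ∈ p.support → v ∈ q.support → G.Adj u v →
      v ∈ p.support ∨ u ∈ q.support := by
    intro u v hu hv huv
    have h1 := hpB u hu
    have h2 := hqA v hv
    simp only [mem_union, mem_insert_iff, mem_singleton_iff, mem_compl_iff] at h1 h2
    rcases h1 with (rfl | rfl) | h1
    · exact Or.inr q.end_mem_support
    · exact Or.inr q.start_mem_support
    · rcases h2 with (rfl | rfl) | h2
      · exact Or.inl p.end_mem_support
      · exact Or.inl p.start_mem_support
      · exact absurd huv (h.not_adj h1 h2)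
  have hpp : ¬ (u ∈ p.support ∧ v ∈ p.support) := fun h => hne'.1 (hpc.mem_edges h.1 h.2 huv)
  have hqq : ¬ (u ∈ q.support ∧ v ∈ q.support) := fun h => hne'.2 (hqc.mem_edges h.1 h.2 huv)
  have h1 := hboth u v
  have h2 := hboth v u
  have h3 := huv.symm
  tauto

/-- A chordal graph that is not complete has a minimum proper separation, and its boundary is a
clique. -/
theorem IsChordal.exists_minimal_separation [Finite V] (hG : IsChordal G) (hne : G ≠ ⊤) :
    ∃ A B, IsSeparation G A B ∧ Aᶜ.Nonempty ∧ Bᶜ.Nonempty ∧ G.IsClique (A ∩ B) ∧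
      SeparationsOrderGE (A ∩ B).ncard G := by
  classical
  obtain ⟨a, b, hab, hadj⟩ := SimpleGraph.ne_top_iff_exists_not_adj.1 hne
  have hex : ∃ n, ∃ A B, IsSeparation G A B ∧ Aᶜ.Nonempty ∧ Bᶜ.Nonempty ∧ (A ∩ B).ncard = n :=
    ⟨_, _, _, isSeparation_compl_singleton hab hadj, by simp, by simp, rfl⟩
  obtain ⟨A, B, h, hA, hB, hn⟩ := Nat.find_spec hex
  have hmin : SeparationsOrderGE (A ∩ B).ncard G := fun C D h' hC hD =>
    hn ▸ Nat.find_min' hex ⟨C, D, h', hC, hD, rfl⟩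
  exact ⟨A, B, h, hA, hB, hG.isClique_inter h hA hB hmin, hmin⟩

/-! ### Generic placements -/

/-- The reals contain arbitrarily large finite algebraically independent families over `ℚ`. -/
theorem exists_isGeneric (V : Type*) [Finite V] (d : ℕ) : ∃ p : Placement V d, IsGeneric p := by
  obtain ⟨s, hs⟩ := exists_isTranscendenceBasis ℚ ℝ
  have hinf : s.Infinite := by
    -- otherwise `ℝ` would be algebraic over a countable ring
    intro hfin
    have := hfin.to_subtype
    have hs' : Algebra.IsAlgebraic (Algebra.adjoin ℚ (range ((↑) : s → ℝ))) ℝ := hs.isAlgebraic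
    have h1 := Algebra.IsAlgebraic.cardinalMk_le_max (Algebra.adjoin ℚ (range ((↑) : s → ℝ))) ℝ
    have h2 : Countable (Algebra.adjoin ℚ (range ((↑) : s → ℝ))) := by
      have : Countable (MvPolynomial s ℚ) := by
        rw [← Cardinal.mk_le_aleph0_iff]
        exact MvPolynomial.cardinalMk_le_max_lift.trans (by simp)
      exact hs.1.aevalEquiv.surjective.countable
    rw [Cardinal.mk_real, max_eq_right (Cardinal.mk_le_aleph0_iff.2 h2)] at h1
    exact absurd h1 (not_le.2 Cardinal.aleph0_lt_continuum)
  have := hinf.to_subtype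
  obtain ⟨n, ⟨e⟩⟩ := Finite.exists_equiv_fin (V × Fin d)
  let f : V × Fin d ↪ s := e.toEmbedding.trans (Fin.valEmbedding.trans (Infinite.natEmbedding s))
  exact ⟨fun v => WithLp.toLp 2 fun i => (f (v, i) : ℝ), hs.1.comp f f.injective⟩

/-- No hyperplane `⟪n, ·⟫ = c` contains the images of more than `d` vertices. -/
def InGeneralPosition {d : ℕ} (p : Placement V d) : Prop :=
  ∀ K : Set V, d + 1 ≤ K.ncard → ∀ (n : EuclideanSpace ℝ (Fin d)) (c : ℝ),
    (∀ x ∈ K, inner ℝ n (p x) = c) → n = 0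

theorem IsGeneric.inGeneralPosition {d : ℕ} {p : Placement V d} (hp : IsGeneric p) :
    InGeneralPosition p := by
  intro K hK n c hn
  have hfin : K.Finite := finite_of_ncard_pos (by omega)
  have := hfin.fintype
  obtain ⟨s⟩ : Nonempty (Fin (d + 1) ↪ K) := by
    rw [Function.Embedding.nonempty_iff_card_le, Fintype.card_fin, ← Nat.card_eq_fintype_card]
    exact hK
  -- the determinant of the edge vectors at `s 0` is a polynomial in the coordinates that does not
  -- vanish identically
  let P : Matrix (Fin d) (Fin d) (MvPolynomial (V × Fin d) ℚ) :=
    .of fun i j => .X ((s i.succ : V), j) - .X ((s 0 : V), j)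
  let M : Matrix (Fin d) (Fin d) ℝ := .of fun i j => p (s i.succ) j - p (s 0) j
  have hPM : MvPolynomial.aeval (fun x : V × Fin d => p x.1 x.2) P.det = M.det := by
    rw [AlgHom.map_det]
    congr 1
    ext i j
    simp [P, M]
  have hP : P.det ≠ 0 := by
    classical
    intro h0
    let φ : MvPolynomial (V × Fin d) ℚ →ₐ[ℚ] ℚ :=
      MvPolynomial.aeval fun x => if x.1 = (s x.2.succ : V) then 1 else 0
    have h1 : φ P.det = 1 := by
      rw [AlgHom.map_det]
      convert Matrix.det_one (n := Fin d) (R := ℚ)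
      ext i j
      simp [P, φ, Matrix.one_apply, Subtype.val_inj, Fin.ext_iff]
    rw [h0, map_zero] at h1
    exact zero_ne_one h1
  have hM : M.det ≠ 0 := by
    rw [← hPM]
    intro h0
    exact hP (hp (by rw [h0, map_zero]))
  have hmul : M.mulVec n.ofLp = 0 := by
    ext i
    have h1 := hn _ (s i.succ).2
    have h2 := hn _ (s 0).2
    rw [PiLp.inner_apply] at h1 h2
    simp only [RCLike.inner_apply, conj_trivial] at h1 h2
    simp only [Matrix.mulVec, dotProduct, M, Matrix.of_apply, sub_mul, Finset.sum_sub_distrib,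
      Pi.zero_apply]
    rw [h1, h2, sub_self]
  ext i
  exact congrFun (Matrix.eq_zero_of_mulVec_eq_zero hM hmul) i

theorem InGeneralPosition.comp_val {d : ℕ} {p : Placement V d} (hp : InGeneralPosition p)
    (A : Set V) : InGeneralPosition fun x : A => p x := by
  intro K hK n c hn
  refine hp (Subtype.val '' K) ?_ n c ?_
  · rwa [ncard_image_of_injective _ Subtype.val_injective]
  · rintro _ ⟨x, hx, rfl⟩
    exact hn x hx

/-! ### Gluing frameworks along `d + 1` common points -/

section Gluing

variable {E F : Type*} [NormedAddCommGroup E] [InnerProductSpace ℝ E] [NormedAddCommGroup F]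
  [InnerProductSpace ℝ F]

theorem inner_sub_eq_of_dist_eq {a b o : E} {a' b' o' : F} (ha : dist a o = dist a' o')
    (hb : dist b o = dist b' o') (hab : dist a b = dist a' b') :
    inner ℝ (a - o) (b - o) = inner ℝ (a' - o') (b' - o') := by
  rw [real_inner_eq_norm_mul_self_add_norm_mul_self_sub_norm_sub_mul_self_div_two,
    real_inner_eq_norm_mul_self_add_norm_mul_self_sub_norm_sub_mul_self_div_two,
    sub_sub_sub_cancel_right, sub_sub_sub_cancel_right]
  simp only [← dist_eq_norm, ha, hb, hab]

theorem dist_eq_of_inner_sub_eq {a b o : E} {a' b' o' : F} (ha : dist a o = dist a' o')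
    (hb : dist b o = dist b' o') (h : inner ℝ (a - o) (b - o) = inner ℝ (a' - o') (b' - o')) :
    dist a b = dist a' b' := by
  rw [real_inner_eq_norm_mul_self_add_norm_mul_self_sub_norm_sub_mul_self_div_two,
    real_inner_eq_norm_mul_self_add_norm_mul_self_sub_norm_sub_mul_self_div_two,
    sub_sub_sub_cancel_right, sub_sub_sub_cancel_right] at h
  simp only [← dist_eq_norm, ha, hb] at h
  rw [← abs_of_nonneg (dist_nonneg (x := a)), ← abs_of_nonneg (dist_nonneg (x := a')),
    ← sq_eq_sq_iff_abs_eq_abs]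
  linarith

/-- If `x = ∑ cᵢ eᵢ`, then `x'` has the same coordinates with respect to `f`, because the squared
norm of `x' - ∑ cᵢ fᵢ` is determined by the given inner products. Hence `⟪x, y⟫` is determined by
the inner products of `y` with the `eᵢ`. -/
theorem inner_eq_of_mem_span {ι : Type*} [Finite ι] {e : ι → E} {f : ι → F} {x y : E} {x' y' : F}
    (hef : ∀ i j, inner ℝ (e i) (e j) = inner ℝ (f i) (f j))
    (hx : ∀ i, inner ℝ (e i) x = inner ℝ (f i) x') (hy : ∀ i, inner ℝ (e i) y = inner ℝ (f i) y')
    (hxx : inner ℝ x x = inner ℝ x' x') (hspan : x ∈ Submodule.span ℝ (range e)) :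
    inner ℝ x y = inner ℝ x' y' := by
  have := Fintype.ofFinite ι
  obtain ⟨c, rfl⟩ := (Submodule.mem_span_range_iff_exists_fun ℝ).1 hspan
  have hlin : ∀ z z', (∀ i, inner ℝ (e i) z = inner ℝ (f i) z') →
      inner ℝ (∑ i, c i • e i) z = inner ℝ (∑ i, c i • f i) z' := by
    intro z z' hz
    simp only [sum_inner, real_inner_smul_left, hz]
  have hx' : x' = ∑ i, c i • f i := by
    have h1 := hlin _ _ hx
    have h2 := hlin (∑ i, c i • e i) (∑ i, c i • f i) fun j => by
      rw [inner_sum, inner_sum]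
      simp only [real_inner_smul_right, hef]
    rw [← sub_eq_zero, ← inner_self_eq_zero (𝕜 := ℝ), inner_sub_left, inner_sub_right,
      inner_sub_right, ← hxx, real_inner_comm (∑ i, c i • f i) x', ← h1, ← h2, sub_self]
  rw [hx', hlin _ _ hy]

end Gluing

/-- If a placement `q` preserves the distances of `p` within `K ∪ {u}` and within `K ∪ {w}`, where
`K` spans the space affinely, then it preserves the distance between `u` and `w`. -/
theorem InGeneralPosition.dist_eq {d : ℕ} {p q : Placement V d} (hp : InGeneralPosition p)
    {K : Set V} (hK : d + 1 ≤ K.ncard) {u w : V}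
    (hKK : ∀ x ∈ K, ∀ y ∈ K, dist (p x) (p y) = dist (q x) (q y))
    (hu : ∀ x ∈ K, dist (p u) (p x) = dist (q u) (q x))
    (hw : ∀ x ∈ K, dist (p w) (p x) = dist (q w) (q x)) :
    dist (p u) (p w) = dist (q u) (q w) := by
  obtain ⟨o, ho⟩ : K.Nonempty := nonempty_of_ncard_ne_zero (by omega)
  have : Finite K := finite_of_ncard_pos (by omega)
  refine dist_eq_of_inner_sub_eq (hu o ho) (hw o ho) ?_
  refine inner_eq_of_mem_span (e := fun x : K => p x - p o) (f := fun x : K => q x - q o)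
    (fun i j => inner_sub_eq_of_dist_eq (hKK _ i.2 _ ho) (hKK _ j.2 _ ho) (hKK _ i.2 _ j.2))
    (fun i => inner_sub_eq_of_dist_eq (hKK _ i.2 _ ho) (hu o ho) ?_)
    (fun i => inner_sub_eq_of_dist_eq (hKK _ i.2 _ ho) (hw o ho) ?_)
    (inner_sub_eq_of_dist_eq (hu o ho) (hu o ho) (by simp)) ?_
  · rw [dist_comm, hu _ i.2, dist_comm]
  · rw [dist_comm, hw _ i.2, dist_comm]
  · have htop : Submodule.span ℝ (range fun x : K => p x - p o) = ⊤ := by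
      rw [← Submodule.orthogonal_eq_bot_iff, Submodule.eq_bot_iff]
      intro n hn
      refine hp K hK n (inner ℝ n (p o)) fun x hx => ?_
      have := Submodule.inner_left_of_mem_orthogonal
        (Submodule.subset_span (mem_range_self (⟨x, hx⟩ : K))) hn
      rwa [inner_sub_right, sub_eq_zero] at this
    rw [htop]
    trivial

/-- In a chordal graph all of whose separations have order more than `d`, every pair of vertices is
globally linked for every placement in general position. -/
theorem IsChordal.globallyLinkedIn {d : ℕ} {V : Type*} [Finite V] {G : SimpleGraph V}
    (hG : IsChordal G) (hk : SeparationsOrderGE (d + 1) G) {p : Placement V d}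
    (hp : InGeneralPosition p) (u v : V) : GloballyLinkedIn G p u v := by
  induction hn : Nat.card V using Nat.strong_induction_on generalizing V with
  | _ n ih =>
    intro q hq
    by_cases htop : G = ⊤
    · by_cases huv : u = v
      · simp [huv]
      · exact hq u v (by simpa [htop] using huv)
    obtain ⟨A, B, h, hA, hB, hcl, -⟩ := hG.exists_minimal_separation htop
    have part : ∀ {A B : Set V}, IsSeparation G A B → Aᶜ.Nonempty → G.IsClique (A ∩ B) →
        ∀ x ∈ A, ∀ y ∈ A, dist (p x) (p y) = dist (q x) (q y) := by
      intro A B h hA hcl x hx y hy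
      have hlt : Nat.card A < n := by
        rw [← hn]
        exact ncard_lt_card (nonempty_compl.1 hA)
      exact ih _ hlt (hG.induce A) (hk.induce_left h hcl) (hp.comp_val A) ⟨x, hx⟩ ⟨y, hy⟩ rfl
        (fun z => q z) fun a b hab => hq a b hab
    have hpA := part h hA hcl
    have hpB := part h.symm hB (by rwa [inter_comm])
    have hK : d + 1 ≤ (A ∩ B).ncard := hk h hA hB
    have cross : ∀ u ∈ A, ∀ v ∈ B, dist (p u) (p v) = dist (q u) (q v) := fun u hu v hv =>
      hp.dist_eq hK (fun x hx y hy => hpA x hx.1 y hy.1) (fun x hx => hpA u hu x hx.1)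
        fun x hx => hpB v hv x hx.2
    rcases h.mem_or_mem u with hu | hu <;> rcases h.mem_or_mem v with hv | hv
    · exact hpA u hu v hv
    · exact cross u hu v hv
    · rw [dist_comm, cross v hv u hu, dist_comm]
    · exact hpB u hu v hv

/-! ### Reflecting one side of a separation -/

/-- Two vertices on different sides of a separation of order `d` are globally loose: reflecting one
side in the hyperplane through the `d` common points preserves all edge lengths, and changes the
distance of the two vertices since neither lies on that hyperplane. -/
theorem IsSeparation.globallyLoose {d : ℕ} (hd : 1 ≤ d) (h : IsSeparation G A B)
    (hAB : (A ∩ B).ncard = d) {u v : V} (hu : u ∉ B) (hv : v ∉ A) : GloballyLoose d G u v := by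
  classical
  rintro ⟨p, hgen, hl⟩
  have hp := hgen.inGeneralPosition
  have hfin : (A ∩ B).Finite := finite_of_ncard_pos (by omega)
  have := hfin.fintype
  obtain ⟨o, ho⟩ : (A ∩ B).Nonempty := nonempty_of_ncard_ne_zero (by omega)
  -- a hyperplane `⟪n, ·⟫ = c` through the common points
  obtain ⟨n, c, hn, hc⟩ : ∃ (n : EuclideanSpace ℝ (Fin d)) (c : ℝ), ‖n‖ = 1 ∧
      ∀ x ∈ A ∩ B, inner ℝ n (p x) = c := by
    let L : (EuclideanSpace ℝ (Fin d) × ℝ) →ₗ[ℝ] ((A ∩ B : Set V) → ℝ) :=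
      LinearMap.pi fun x => (innerₗ (EuclideanSpace ℝ (Fin d)) (p x)).comp (LinearMap.fst ..) -
        LinearMap.snd ..
    have hL : LinearMap.ker L ≠ ⊥ := L.ker_ne_bot_of_finrank_lt (by
      rw [Module.finrank_prod, Module.finrank_fintype_fun_eq_card, finrank_euclideanSpace_fin,
        Module.finrank_self, ← Nat.card_eq_fintype_card]
      have : Nat.card (A ∩ B : Set V) = d := hAB
      omega)
    obtain ⟨⟨n, c⟩, hz, hz0⟩ := Submodule.exists_mem_ne_zero_of_ne_bot hL
    have hLx : ∀ x ∈ A ∩ B, inner ℝ n (p x) = c := by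
      intro x hx
      have := congrFun (LinearMap.mem_ker.1 hz) ⟨x, hx⟩
      simp only [L, LinearMap.pi_apply, LinearMap.sub_apply, LinearMap.comp_apply,
        LinearMap.fst_apply, LinearMap.snd_apply, innerₗ_apply_apply, Pi.zero_apply] at this
      rw [real_inner_comm]
      linarith
    have hn0 : n ≠ 0 := by
      rintro rfl
      refine hz0 ?_
      rw [← hLx o ho, inner_zero_left]
      rfl
    refine ⟨‖n‖⁻¹ • n, ‖n‖⁻¹ * c, norm_smul_inv_norm hn0, fun x hx => ?_⟩
    rw [real_inner_smul_left, hLx x hx]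
  have hoff : ∀ x, x ∉ A ∩ B → inner ℝ n (p x) ≠ c := by
    intro x hx hxc
    have h0 : n = 0 := hp (insert x (A ∩ B)) (by rw [ncard_insert_of_notMem hx hfin, hAB]) n c (by
      rintro y (rfl | hy)
      · exact hxc
      · exact hc y hy)
    simp [h0] at hn
  -- the signed distance to the hyperplane and the reflection in it
  let t : V → ℝ := fun x => inner ℝ n (p x) - c
  let r : V → EuclideanSpace ℝ (Fin d) := fun x => p x - (2 * t x) • n
  have hr : ∀ x ∈ A ∩ B, r x = p x := by
    intro x hx
    simp [r, t, hc x hx]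
  have hrr : ∀ x y, dist (r x) (r y) ^ 2 = dist (p x) (p y) ^ 2 := by
    intro x y
    have : r x - r y = (p x - p y) - (2 * (t x - t y)) • n := by
      simp only [r]
      module
    rw [dist_eq_norm, dist_eq_norm, this, norm_sub_sq_real, real_inner_smul_right,
      real_inner_comm, inner_sub_right, norm_smul, hn, mul_one, Real.norm_eq_abs, sq_abs]
    simp only [t]
    ring
  have hpr : ∀ x y, dist (p x) (r y) ^ 2 = dist (p x) (p y) ^ 2 + 4 * t x * t y := by
    intro x y
    have : p x - r y = (p x - p y) + (2 * t y) • n := by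
      simp only [r]
      module
    rw [dist_eq_norm, dist_eq_norm, this, norm_add_sq_real, real_inner_smul_right,
      real_inner_comm, inner_sub_right, norm_smul, hn, mul_one, Real.norm_eq_abs, sq_abs]
    simp only [t]
    ring
  let q : Placement V d := fun x => if x ∈ A then p x else r x
  have hqA : ∀ x ∈ A, q x = p x := fun x hx => if_pos hx
  have hqB : ∀ x ∈ B, q x = r x := by
    intro x hx
    by_cases hxA : x ∈ A
    · rw [hqA x hxA, hr x ⟨hxA, hx⟩]
    · exact if_neg hxA
  have hq : Equivalent G p q := by
    intro x y hxy
    rcases h.mem_and_mem_of_adj hxy with hA | hB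
    · rw [hqA x hA.1, hqA y hA.2]
    · rw [hqB x hB.1, hqB y hB.2]
      exact (sq_eq_sq₀ dist_nonneg dist_nonneg).1 (hrr x y).symm
  have huA := (h.mem_or_mem u).resolve_right hu
  have hvB := (h.mem_or_mem v).resolve_left hv
  have huv := hl q hq
  rw [hqA u huA, hqB v hvB] at huv
  have hzero := hpr u v
  rw [← huv] at hzero
  have h1 : t u ≠ 0 := sub_ne_zero.2 (hoff u fun h => hu h.2)
  have h2 : t v ≠ 0 := sub_ne_zero.2 (hoff v fun h => hv h.1)
  have h3 : 4 * t u * t v ≠ 0 := by positivity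
  exact h3 (by linarith)

/-! ### Gluing along a clique boundary -/

/-- The union, on the vertex set `V`, of graphs on two subsets `A` and `B` of `V`. -/
def glue (H₁ : SimpleGraph A) (H₂ : SimpleGraph B) : SimpleGraph V :=
  H₁.map (Function.Embedding.subtype _) ⊔ H₂.map (Function.Embedding.subtype _)

theorem glue_adj {H₁ : SimpleGraph A} {H₂ : SimpleGraph B} {x y : V} :
    (glue H₁ H₂).Adj x y ↔ (∃ (hx : x ∈ A) (hy : y ∈ A), H₁.Adj ⟨x, hx⟩ ⟨y, hy⟩) ∨
      ∃ (hx : x ∈ B) (hy : y ∈ B), H₂.Adj ⟨x, hx⟩ ⟨y, hy⟩ := by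
  simp only [glue, SimpleGraph.sup_adj, SimpleGraph.map_adj, Function.Embedding.subtype_apply]
  refine or_congr ?_ ?_
  all_goals
    constructor
    · rintro ⟨a, b, hab, rfl, rfl⟩
      exact ⟨a.2, b.2, hab⟩
    · rintro ⟨hx, hy, hab⟩
      exact ⟨_, _, hab, rfl, rfl⟩

theorem glue_comm (H₁ : SimpleGraph A) (H₂ : SimpleGraph B) : glue H₁ H₂ = glue H₂ H₁ :=
  sup_comm ..

section

variable {H₁ : SimpleGraph A} {H₂ : SimpleGraph B}

theorem isSeparation_glue (h : A ∪ B = univ) : IsSeparation (glue H₁ H₂) A B := by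
  refine ⟨h, fun x y hx hy hxy => ?_⟩
  rcases glue_adj.1 hxy with ⟨-, hy', -⟩ | ⟨hx', -⟩
  · exact hy hy'
  · exact hx hx'

theorem le_glue (h : IsSeparation G A B) (h₁ : G.induce A ≤ H₁) (h₂ : G.induce B ≤ H₂) :
    G ≤ glue H₁ H₂ := by
  intro x y hxy
  rw [glue_adj]
  exact (h.mem_and_mem_of_adj hxy).imp (fun hA => ⟨hA.1, hA.2, h₁ hxy⟩)
    fun hB => ⟨hB.1, hB.2, h₂ hxy⟩

/-- If `A ∩ B` is a clique of `H₁`, gluing adds no edges inside `A`. -/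
theorem induce_glue_left (hK : ∀ x y : A, x ≠ y → x.1 ∈ B → y.1 ∈ B → H₁.Adj x y) :
    (glue H₁ H₂).induce A = H₁ := by
  ext x y
  rw [SimpleGraph.induce_adj, glue_adj]
  constructor
  · rintro (⟨_, _, h⟩ | ⟨hx, hy, h⟩)
    · exact h
    · exact hK x y (fun e => h.ne (Subtype.ext (congrArg (Subtype.val (p := (· ∈ A))) e))) hx hy
  · exact fun h => Or.inl ⟨x.2, y.2, h⟩

end

/-- Two distinct non-adjacent vertices are always separated by exactly `d` vertices. -/
def HasSeparations (d : ℕ) (G : SimpleGraph V) : Prop :=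
  ∀ u v, u ≠ v → ¬ G.Adj u v → ∃ A B, IsSeparation G A B ∧ (A ∩ B).ncard = d ∧ u ∉ B ∧ v ∉ A

theorem HasSeparations.totallyLoose {d : ℕ} (hd : 1 ≤ d) (h : HasSeparations d G) :
    TotallyLoose d G := by
  intro u v huv hadj
  obtain ⟨A, B, hs, hAB, hu, hv⟩ := h u v huv hadj
  exact hs.globallyLoose hd hAB hu hv

/-- Separations of a part extend to the whole graph when the boundary of the part is a clique. -/
theorem IsSeparation.exists_of_induce {d : ℕ} (h : IsSeparation G A B) (hK : G.IsClique (A ∩ B))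
    (hA : HasSeparations d (G.induce A)) {u v : V} (hu : u ∈ A) (hv : v ∈ A) (huv : u ≠ v)
    (hadj : ¬ G.Adj u v) :
    ∃ A B, IsSeparation G A B ∧ (A ∩ B).ncard = d ∧ u ∉ B ∧ v ∉ A := by
  obtain ⟨C, D, hs, hCD, hu', hv'⟩ :=
    hA ⟨u, hu⟩ ⟨v, hv⟩ (fun e => huv (congrArg Subtype.val e)) hadj
  rcases hs.subset_or_subset_of_isClique (isClique_induce_of_inter hK) with hC | hC
  · refine ⟨_, _, h.extend hs, ?_, notMem_image_val hu', notMem_extend hC hv'⟩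
    rw [inter_extend_eq (B := B) hC, ncard_image_of_injective _ Subtype.val_injective, hCD]
  · refine ⟨_, _, (h.extend hs.symm).symm, ?_, notMem_extend hC hu', notMem_image_val hv'⟩
    rw [inter_comm, inter_extend_eq (B := B) hC, ncard_image_of_injective _ Subtype.val_injective,
      inter_comm, hCD]

theorem IsSeparation.hasSeparations {d : ℕ} (h : IsSeparation G A B) (hK : G.IsClique (A ∩ B))
    (hAB : (A ∩ B).ncard = d) (hA : HasSeparations d (G.induce A))
    (hB : HasSeparations d (G.induce B)) : HasSeparations d G := by
  intro u v huv hadj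
  by_cases hA' : u ∈ A ∧ v ∈ A
  · exact h.exists_of_induce hK hA hA'.1 hA'.2 huv hadj
  by_cases hB' : u ∈ B ∧ v ∈ B
  · exact h.symm.exists_of_induce (by rwa [inter_comm]) hB hB'.1 hB'.2 huv hadj
  have hu := h.mem_or_mem u
  have hv := h.mem_or_mem v
  by_cases hu' : u ∈ B
  · exact ⟨B, A, h.symm, by rwa [inter_comm], by tauto, by tauto⟩
  · exact ⟨A, B, h, hAB, hu', by tauto⟩

theorem IsSeparation.isCliqueSum {t : ℕ} (ht : t ≠ 0) (h : IsSeparation G A B)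
    (hK : G.IsClique (A ∩ B)) (hAB : (A ∩ B).ncard = t) :
    IsCliqueSum t (G.induce A) (G.induce B) G := by
  have hrange : ∀ C : Set V, range (SimpleGraph.Embedding.induce (G := G) C) = C := fun C =>
    Subtype.range_coe
  refine ⟨SimpleGraph.Embedding.induce A, SimpleGraph.Embedding.induce B, ?_⟩
  rw [hrange, hrange]
  refine ⟨h.union_eq, hK, ?_, fun x y hxy => h.mem_and_mem_of_adj hxy⟩
  rw [← hAB, (finite_of_ncard_ne_zero (hAB ▸ ht)).cast_ncard_eq]

/-! ### The totally loose closure -/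

/-- The closure of a `d`-connected chordal graph, built along its clique boundaries of size `d`.
The last clause says that it adds only pairs that are globally linked in `G`. -/
theorem IsChordal.exists_cliqueSum {d : ℕ} (hd : 1 ≤ d) {V : Type*} [Finite V]
    {G : SimpleGraph V} (hG : IsChordal G) (hk : SeparationsOrderGE d G) :
    ∃ H : SimpleGraph V, G ≤ H ∧ IsCliqueSumOfComplete d H ∧ HasSeparations d H ∧
      ∀ p : Placement V d, InGeneralPosition p → ∀ u v, H.Adj u v → GloballyLinkedIn G p u v := by
  induction hn : Nat.card V using Nat.strong_induction_on generalizing V with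
  | _ n ih =>
    -- a complete closure has no non-adjacent pairs to separate
    have complete : (∀ p : Placement V d, InGeneralPosition p → ∀ u v, GloballyLinkedIn G p u v) →
        ∃ H : SimpleGraph V, G ≤ H ∧ IsCliqueSumOfComplete d H ∧ HasSeparations d H ∧
          ∀ p : Placement V d, InGeneralPosition p → ∀ u v, H.Adj u v →
            GloballyLinkedIn G p u v := fun hl =>
      ⟨⊤, le_top, .complete _ rfl, fun u v huv hadj => absurd huv hadj,
        fun p hp u v _ => hl p hp u v⟩
    by_cases htop : G = ⊤
    · refine complete fun p _ u v q hq => ?_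
      by_cases huv : u = v
      · simp [huv]
      · exact hq u v (by simpa [htop] using huv)
    obtain ⟨A, B, h, hA, hB, hcl, hmin⟩ := hG.exists_minimal_separation htop
    rcases (hk h hA hB).lt_or_eq with hlt | hAB
    · exact complete fun p hp => hG.globallyLinkedIn
        (fun C D hs hC hD => hlt.trans_le (hmin hs hC hD)) hp
    have part : ∀ {A B : Set V}, IsSeparation G A B → Aᶜ.Nonempty → G.IsClique (A ∩ B) →
        ∃ H : SimpleGraph A, G.induce A ≤ H ∧ IsCliqueSumOfComplete d H ∧ HasSeparations d H ∧
          ∀ p : Placement A d, InGeneralPosition p → ∀ u v, H.Adj u v →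
            GloballyLinkedIn (G.induce A) p u v := by
      intro A B h hA hcl
      have hlt : Nat.card A < n := by
        rw [← hn]
        exact ncard_lt_card (nonempty_compl.1 hA)
      exact ih _ hlt (hG.induce A) (hk.induce_left h hcl) rfl
    obtain ⟨H₁, hle₁, hsum₁, hsep₁, hl₁⟩ := part h hA hcl
    obtain ⟨H₂, hle₂, hsum₂, hsep₂, hl₂⟩ := part h.symm hB (by rwa [inter_comm])
    have hs : IsSeparation (glue H₁ H₂) A B := isSeparation_glue h.union_eq
    have hle : G ≤ glue H₁ H₂ := le_glue h hle₁ hle₂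
    have hK : (glue H₁ H₂).IsClique (A ∩ B) := hcl.mono hle
    have he₁ : (glue H₁ H₂).induce A = H₁ := induce_glue_left fun x y hne hx hy =>
      hle₁ (hcl ⟨x.2, hx⟩ ⟨y.2, hy⟩ fun e => hne (Subtype.ext e))
    have he₂ : (glue H₁ H₂).induce B = H₂ := by
      rw [glue_comm]
      exact induce_glue_left fun x y hne hx hy =>
        hle₂ (hcl ⟨hx, x.2⟩ ⟨hy, y.2⟩ fun e => hne (Subtype.ext e))
    refine ⟨glue H₁ H₂, hle, ?_, ?_, ?_⟩
    · refine .sum H₁ H₂ _ hsum₁ hsum₂ ?_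
      have := hs.isCliqueSum (by omega) hK hAB.symm
      rwa [he₁, he₂] at this
    · exact hs.hasSeparations hK hAB.symm (by rwa [he₁]) (by rwa [he₂])
    · intro p hp u v huv q hq
      rcases glue_adj.1 huv with ⟨hu, hv, hadj⟩ | ⟨hu, hv, hadj⟩
      · exact hl₁ _ (hp.comp_val A) _ _ hadj (fun x => q x) fun a b hab => hq a b hab
      · exact hl₂ _ (hp.comp_val B) _ _ hadj (fun x => q x) fun a b hab => hq a b hab

/-- A totally loose supergraph of `G` whose edges are globally linked in `G` for placements in
general position is the totally loose closure of `G`. -/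
theorem tlc_eq_of_globallyLinkedIn {V : Type*} [Finite V] {d : ℕ} {G H : SimpleGraph V}
    (hle : G ≤ H) (hH : TotallyLoose d H)
    (hl : ∀ p : Placement V d, InGeneralPosition p → ∀ u v, H.Adj u v → GloballyLinkedIn G p u v) :
    tlc d G = H := by
  refine le_antisymm ((isLeast_tlc d G).2 ⟨hle, hH⟩) fun u v huv => ?_
  by_contra hadj
  obtain ⟨p, hp⟩ := exists_isGeneric V d
  have hw : WeaklyGloballyLinked d G u v := ⟨p, hp, hl p hp.inGeneralPosition u v huv⟩
  exact (isLeast_tlc d G).1.2 u v huv.ne hadj (hw.mono (isLeast_tlc d G).1.1)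

end Rigidity

theorem mainTheorem10 {V : Type*} [Finite V] (d : ℕ) (hd : 1 ≤ d) (G : SimpleGraph V)
    (hconn : Rigidity.IsKConnected d G) (hchordal : Rigidity.IsChordal G) :
    Rigidity.IsCliqueSumOfComplete d (Rigidity.tlc d G) := by
  obtain ⟨H, hle, hsum, hsep, hl⟩ := hchordal.exists_cliqueSum hd hconn.separationsOrderGE
  rwa [Rigidity.tlc_eq_of_globallyLinkedIn hle (hsep.totallyLoose hd) hl]
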